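/- Let $k\ge 1$. Define the well-ordering $\prec$ on $\mathbb{Z}^k$ recursively as follows. On $\mathbb{Z}=\mathbb{Z}^1$ it is $$0\prec 1\prec -1\prec 2\prec -2\prec 3\prec\cdots .$$ For $k>1$ and $u\in\mathbb{Z}^k$ let $M(u)$ be the largest entry of $u$ with respect to $\prec$ on $\mathbb{Z}$, let $i_u=\min\{i : u_i=M(u)\}$, and let $u'\in\mathbb{Z}^{k-1}$ be obtained from $u$ by deleting its $i_u$-th coordinate. For $u\neq v$ in $\mathbb{Z}^k$, put $u\prec v$ if and only if one of the following holds: $M(u)\prec M(v)$; or $M(u)=M(v)$ and $i_v<i_u$; or $M(u)=M(v)$, $i_u=i_v$ and $u'\prec v'$. A finite set $S\subset\mathbb{Z}^k$ is an initial segment if $v\in S$ and $u\prec v$ imply $u\in S$. For $I\subseteq\{1,\dots,k\}$ and a finite set $X\subset\mathbb{Z}^k$ let $P_I(X)\subset\mathbb{Z}^{k-|I|}$ be the projection of $X$ obtained by deleting the coordinates in $I$. For $n\ge 0$ let $X_n$ denote the set of all subsets $X\subset\mathbb{Z}^k$ of size $n$, and define $f:X_n\to\mathbb{R}$ by $$f(X)=\sum_{I\subseteq\{1,\dots,k\}}2^{|I|}\,|P_I(X)|.$$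 Then there is exactly one initial segment $S$ of $(\mathbb{Z}^k,\prec)$ of size $n$, and the minimum value of $f$ on $X_n$ is achieved at $S$: $f(S)\le f(X)$ for all $X\in X_n$. -/

import Mathlib

/-- The position of the integer `a` in the list `0, 1, -1, 2, -2, 3, -3, …`
(counted from `0`). -/
def intRank (a : ℤ) : ℕ :=
  if 0 < a then 2 * a.natAbs - 1 else 2 * a.natAbs

/-- The well-ordering `0 ≺ 1 ≺ -1 ≺ 2 ≺ -2 ≺ 3 ≺ ⋯` of the integers. -/
def IntPrec (a b : ℤ) : Prop :=
  intRank a < intRank b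

/-- The set of coordinates at which `u` attains its `≺`-largest entry. -/
def maxIndices {k : ℕ} (u : Fin (k + 1) → ℤ) : Finset (Fin (k + 1)) :=
  {i | ∀ j, intRank (u j) ≤ intRank (u i)}

theorem maxIndices_nonempty {k : ℕ} (u : Fin (k + 1) → ℤ) : (maxIndices u).Nonempty := by
  obtain ⟨i, hi⟩ := Finite.exists_max (fun i => intRank (u i))
  exact ⟨i, by simpa [maxIndices] using hi⟩

/-- The least coordinate `i_u` at which `u` attains its `≺`-largest entry. -/
def firstMaxIndex {k : ℕ} (u : Fin (k + 1) → ℤ) : Fin (k + 1) :=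
  (maxIndices u).min' (maxIndices_nonempty u)

/-- The `≺`-largest entry `M(u)` of `u`. -/
def maxEntry {k : ℕ} (u : Fin (k + 1) → ℤ) : ℤ :=
  u (firstMaxIndex u)

/-- The vector `u'` obtained from `u` by deleting the coordinate `i_u`. -/
def deleteFirstMax {k : ℕ} (u : Fin (k + 1) → ℤ) : Fin k → ℤ :=
  (firstMaxIndex u).removeNth u

/-- The well-ordering `≺` of `ℤ^k`. There is no relation on the one-point space `ℤ^0`, so that
on `ℤ^1` the recursive clause reduces to `IntPrec`. -/
def VecPrec : (k : ℕ) → (Fin k → ℤ) → (Fin k → ℤ) → Prop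
  | 0, _, _ => False
  | k + 1, u, v =>
      IntPrec (maxEntry u) (maxEntry v) ∨
        (maxEntry u = maxEntry v ∧
          (firstMaxIndex v < firstMaxIndex u ∨
            (firstMaxIndex u = firstMaxIndex v ∧
              VecPrec k (deleteFirstMax u) (deleteFirstMax v))))

/-- A finite set is an initial segment of `(ℤ^k, ≺)` if it is closed under `≺`-predecessors. -/
def IsInitialSegment {k : ℕ} (S : Finset (Fin k → ℤ)) : Prop :=
  ∀ v ∈ S, ∀ u, VecPrec k u v → u ∈ S

/-- The projection `P_I(X)`, obtained by deleting the coordinates in `I`, that is, by restricting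
every vector of `X` to the coordinates outside `I`. -/
def deleteCoords {k : ℕ} (I : Finset (Fin k)) (X : Finset (Fin k → ℤ)) :
    Finset ((Iᶜ : Finset (Fin k)) → ℤ) :=
  X.image (Finset.restrict Iᶜ)

/-- The function `f(X) = ∑_{I ⊆ [k]} 2^{|I|} |P_I(X)|`. -/
def projectionSum {k : ℕ} (X : Finset (Fin k → ℤ)) : ℝ :=
  ∑ I : Finset (Fin k), (2 : ℝ) ^ I.card * ((deleteCoords I X).card : ℝ)

/-! Ranking entries moves the problem to `Fin k → ℕ`, where `≺` becomes the colexicographic order on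
graphs, measured by the single number `vecCode`. In a lower set, the projection deleting `I` has as
many points as there are points of the set vanishing on `I`. Summing `2 ^ |I|` over all `I` inside
the zero set of a point gives `3` to the number of its zeros, so on lower sets `f` is the additive
functional `∑ zeroWeight`.

Among lower sets, induct on the dimension and on the sum of codes. If some slice is not an initial
segment, replacing every slice in that direction by one lowers the code sum without raising the
weight. If all slices are initial segments but the set is not, its last point and the first missing
point are so constrained that a swap of the two, or of two short lines through them, keeps a lower
set, lowers the code sum and does not raise the weight
(`exists_sum_vecCode_lt_of_slices_isCodeInitial`).

For an arbitrary set, splitting on whether the first coordinate is deleted gives a recursion for `f`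
in terms of slices and one projection. By induction each of these may be replaced by an initial
segment. Such segments are nested, so they stack into a lower set of the same size whose weight is
bounded by the recursion. -/

/-! ### The colexicographic code -/

/-- The number whose binary digits encode the graph of `u`, so that comparing codes is comparing
the graphs in the colexicographic order. -/
def vecCode {k : ℕ} (u : Fin k → ℕ) : ℕ :=
  ∑ i, 2 ^ (u i * k + (i.rev : ℕ))

/-- As `rev` takes values below `k`, digit positions are ordered first by value and then by index.
The index is reversed because, at equal maxima, the earlier position makes the larger vector. -/
theorem mul_add_rev_lt_iff {k : ℕ} (a b : ℕ) (i j : Fin k) :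
    a * k + (j.rev : ℕ) < b * k + (i.rev : ℕ) ↔ a < b ∨ (a = b ∧ i < j) := by
  have hi := i.rev.isLt
  have hj := j.rev.isLt
  have hij : (j.rev : ℕ) < (i.rev : ℕ) ↔ i < j := by
    rw [← Fin.lt_def, Fin.rev_lt_rev]
  rw [← hij]
  rcases lt_trichotomy a b with h | rfl | h
  · have := Nat.mul_le_mul_right k (Nat.succ_le_of_lt h)
    rw [Nat.succ_mul] at this
    simp only [h, true_or, iff_true]
    omega
  · simp
  · have := Nat.mul_le_mul_right k (Nat.succ_le_of_lt h)
    rw [Nat.succ_mul] at this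
    simp only [h.ne', h.not_gt, false_and, or_false, iff_false]
    omega

theorem mul_add_rev_injective {k : ℕ} {a b : ℕ} {i j : Fin k}
    (h : a * k + (j.rev : ℕ) = b * k + (i.rev : ℕ)) : a = b ∧ i = j := by
  have h1 := (mul_add_rev_lt_iff a b i j).not.1 h.not_lt
  have h2 := (mul_add_rev_lt_iff b a j i).not.1 h.not_gt
  have hab : a = b := by omega
  subst hab
  simp only [lt_irrefl, true_and, false_or, not_lt] at h1 h2
  exact ⟨rfl, le_antisymm h2 h1⟩

/-- The exponents of the binary digits of `vecCode u`. -/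
def vecDigits {k : ℕ} (u : Fin k → ℕ) : Finset ℕ :=
  Finset.univ.image fun i => u i * k + (i.rev : ℕ)

theorem vecCode_eq_sum_vecDigits {k : ℕ} (u : Fin k → ℕ) :
    vecCode u = ∑ d ∈ vecDigits u, 2 ^ d := by
  rw [vecDigits, Finset.sum_image]
  · rfl
  · intro i _ j _ h
    exact (mul_add_rev_injective h).2.symm

theorem mem_vecDigits {k : ℕ} {u : Fin k → ℕ} {a : ℕ} {i : Fin k} :
    a * k + (i.rev : ℕ) ∈ vecDigits u ↔ u i = a := by
  constructor
  · intro h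
    obtain ⟨j, -, hj⟩ := Finset.mem_image.1 h
    obtain ⟨h1, rfl⟩ := mul_add_rev_injective hj
    exact h1
  · rintro rfl
    exact Finset.mem_image_of_mem _ (Finset.mem_univ _)

/-- Some binary digit of `v` absent from `u` exceeds every digit of `u` absent from `v`. The
criterion does not mention the radix `k`, so it survives inserting a coordinate although the radix
becomes `k + 1`. -/
theorem vecCode_lt_iff {k : ℕ} {u v : Fin k → ℕ} :
    vecCode u < vecCode v ↔
      ∃ i, u i ≠ v i ∧ ∀ j, u j ≠ v j → u j < v i ∨ (u j = v i ∧ i < j) := by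
  rw [vecCode_eq_sum_vecDigits, vecCode_eq_sum_vecDigits,
    Finset.geomSum_lt_geomSum_iff_toColex_lt_toColex le_rfl,
    Finset.Colex.toColex_lt_toColex_iff_exists_forall_lt]
  constructor
  · rintro ⟨d, hd, hdu, h⟩
    obtain ⟨i, -, rfl⟩ := Finset.mem_image.1 hd
    rw [mem_vecDigits] at hdu
    refine ⟨i, hdu, fun j hj => ?_⟩
    rw [← mul_add_rev_lt_iff]
    exact h _ (mem_vecDigits.2 rfl) (fun h' => hj (mem_vecDigits.1 h').symm)
  · rintro ⟨i, hi, h⟩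
    refine ⟨_, mem_vecDigits.2 rfl, fun h' => hi (mem_vecDigits.1 h'), fun d hd hdv => ?_⟩
    obtain ⟨j, -, rfl⟩ := Finset.mem_image.1 hd
    rw [mem_vecDigits] at hdv
    exact (mul_add_rev_lt_iff _ _ _ _).2 (h j (Ne.symm hdv))

theorem vecCode_injective {k : ℕ} : Function.Injective (vecCode : (Fin k → ℕ) → ℕ) := by
  intro u v h
  rw [vecCode_eq_sum_vecDigits, vecCode_eq_sum_vecDigits] at h
  have h' : vecDigits u = vecDigits v := Finset.geomSum_injective le_rfl h
  funext i
  exact (mem_vecDigits.1 (h' ▸ mem_vecDigits.2 rfl : v i * k + (i.rev : ℕ) ∈ vecDigits u))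

theorem vecCode_le_of_le {k : ℕ} {u v : Fin k → ℕ} (h : u ≤ v) : vecCode u ≤ vecCode v :=
  Finset.sum_le_sum fun i _ =>
    Nat.pow_le_pow_right two_pos (Nat.add_le_add_right (Nat.mul_le_mul_right k (h i)) _)

theorem vecCode_insertNth_lt_of_lt {k : ℕ} (p : Fin (k + 1)) (t : ℕ) {u v : Fin k → ℕ}
    (h : vecCode u < vecCode v) :
    vecCode (p.insertNth t u : Fin (k + 1) → ℕ) < vecCode (p.insertNth t v : Fin (k + 1) → ℕ) := by
  obtain ⟨i, hi, h⟩ := vecCode_lt_iff.1 h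
  refine vecCode_lt_iff.2 ⟨p.succAbove i, by simpa using hi, fun j hj => ?_⟩
  rcases Fin.eq_self_or_eq_succAbove p j with rfl | ⟨j, rfl⟩
  · simp at hj
  · simp only [Fin.insertNth_apply_succAbove, Fin.succAbove_lt_succAbove_iff] at hj ⊢
    exact h j hj

theorem vecCode_insertNth_lt_iff {k : ℕ} (p : Fin (k + 1)) (t : ℕ) {u v : Fin k → ℕ} :
    vecCode (p.insertNth t u : Fin (k + 1) → ℕ) < vecCode (p.insertNth t v : Fin (k + 1) → ℕ) ↔
      vecCode u < vecCode v := by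
  refine ⟨fun h => ?_, vecCode_insertNth_lt_of_lt p t⟩
  rcases lt_trichotomy (vecCode u) (vecCode v) with h' | h' | h'
  · exact h'
  · rw [vecCode_injective h'] at h
    exact absurd h (lt_irrefl _)
  · exact absurd h (vecCode_insertNth_lt_of_lt p t h').not_gt

/-! ### Initial segments of the code order -/

/-- A finite set of vectors of naturals closed under passing to vectors of smaller code. -/
def IsCodeInitial {k : ℕ} (S : Finset (Fin k → ℕ)) : Prop :=
  ∀ v ∈ S, ∀ u, vecCode u < vecCode v → u ∈ S

theorem IsCodeInitial.isLowerSet {k : ℕ} {S : Finset (Fin k → ℕ)} (hS : IsCodeInitial S) :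
    IsLowerSet (S : Set (Fin k → ℕ)) := by
  intro v u huv hv
  rcases (vecCode_le_of_le huv).lt_or_eq with h | h
  · exact hS v hv u h
  · rwa [vecCode_injective h]

theorem IsCodeInitial.subset_of_card_le {k : ℕ} {S T : Finset (Fin k → ℕ)} (hS : IsCodeInitial S)
    (hT : IsCodeInitial T) (h : S.card ≤ T.card) : S ⊆ T := by
  by_contra hST
  obtain ⟨v, hv, hvT⟩ := Finset.not_subset.1 hST
  have : T ⊆ S := by
    intro u hu
    rcases lt_trichotomy (vecCode u) (vecCode v) with h' | h' | h'
    · exact hS v hv u h'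
    · rwa [vecCode_injective h']
    · exact absurd (hT u hu v h') hvT
  exact hvT (Finset.eq_of_subset_of_card_le this h ▸ hv)

theorem IsCodeInitial.eq_of_card_eq {k : ℕ} {S T : Finset (Fin k → ℕ)} (hS : IsCodeInitial S)
    (hT : IsCodeInitial T) (h : S.card = T.card) : S = T :=
  Finset.eq_of_subset_of_card_le (hS.subset_of_card_le hT h.le) h.ge

/-- Among the sets of a given size, the initial segment has the least sum of any function that
increases with the code. -/
theorem IsCodeInitial.sum_lt_sum {k : ℕ} {S X : Finset (Fin k → ℕ)} (hS : IsCodeInitial S)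
    (hc : S.card = X.card) (hne : S ≠ X) {φ : (Fin k → ℕ) → ℕ}
    (hφ : ∀ u v, vecCode u < vecCode v → φ u < φ v) : ∑ x ∈ S, φ x < ∑ x ∈ X, φ x := by
  have hcard : (S \ X).card = (X \ S).card := by
    have h1 := Finset.card_sdiff_add_card_inter S X
    have h2 := Finset.card_sdiff_add_card_inter X S
    rw [Finset.inter_comm] at h2
    omega
  have hnonempty : (S \ X).Nonempty := by
    rw [Finset.sdiff_nonempty]
    exact fun h => hne (Finset.eq_of_subset_of_card_le h hc.ge)
  have key : ∑ x ∈ S \ X, φ x < ∑ x ∈ X \ S, φ x := by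
    -- Any bijection will do: every point of `S \ X` has smaller code than every point of `X \ S`.
    have e := Finset.equivOfCardEq hcard
    rw [← Finset.sum_coe_sort (S \ X), ← Finset.sum_coe_sort (X \ S), ← Equiv.sum_comp e]
    have : Nonempty ↥(S \ X) := hnonempty.to_subtype
    refine Finset.sum_lt_sum_of_nonempty Finset.univ_nonempty fun a _ => hφ _ _ ?_
    have ha := Finset.mem_sdiff.1 a.2
    have hb := Finset.mem_sdiff.1 (e a).2
    rcases lt_trichotomy (vecCode a.1) (vecCode (e a).1) with h' | h' | h'
    · exact h'
    · exact absurd (vecCode_injective h' ▸ ha.1) hb.2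
    · exact absurd (hS _ ha.1 _ h') hb.2
  exact Finset.sum_sdiff_lt_sum_sdiff.1 key

/-- Repeatedly add the missing point of least code. The set `X` guarantees that a missing point
exists, which covers the one-point space `k = 0`. -/
theorem exists_isCodeInitial_card_eq {k : ℕ} (X : Finset (Fin k → ℕ)) :
    ∃ S : Finset (Fin k → ℕ), IsCodeInitial S ∧ S.card = X.card := by
  suffices h : ∀ n ≤ X.card, ∃ S : Finset (Fin k → ℕ), IsCodeInitial S ∧ S.card = n from
    h _ le_rfl
  intro n
  induction n with
  | zero => exact fun _ => ⟨∅, by simp [IsCodeInitial], rfl⟩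
  | succ n ih =>
    intro hn
    obtain ⟨S, hS, hc⟩ := ih (by omega)
    obtain ⟨z, -, hz⟩ := Finset.exists_mem_notMem_of_card_lt_card (s := S) (t := X) (by omega)
    obtain ⟨y, hy, hmin⟩ := (measure (vecCode : (Fin k → ℕ) → ℕ)).wf.has_min
      ((S : Set (Fin k → ℕ))ᶜ) ⟨z, hz⟩
    have hy' : y ∉ S := hy
    refine ⟨insert y S, ?_, by rw [Finset.card_insert_of_notMem hy', hc]⟩
    intro v hv u huv
    rw [Finset.mem_insert] at hv ⊢
    rcases hv with rfl | hv
    · right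
      by_contra hu
      exact hmin u hu huv
    · exact Or.inr (hS v hv u huv)

/-- The initial segment with as many elements as `X`. -/
noncomputable def codeSegment {k : ℕ} (X : Finset (Fin k → ℕ)) : Finset (Fin k → ℕ) :=
  (exists_isCodeInitial_card_eq X).choose

theorem codeSegment_isCodeInitial {k : ℕ} (X : Finset (Fin k → ℕ)) :
    IsCodeInitial (codeSegment X) :=
  (exists_isCodeInitial_card_eq X).choose_spec.1

theorem card_codeSegment {k : ℕ} (X : Finset (Fin k → ℕ)) : (codeSegment X).card = X.card :=
  (exists_isCodeInitial_card_eq X).choose_spec.2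

theorem IsCodeInitial.eq_codeSegment {k : ℕ} {S X : Finset (Fin k → ℕ)} (hS : IsCodeInitial S)
    (h : S.card = X.card) : S = codeSegment X :=
  hS.eq_of_card_eq (codeSegment_isCodeInitial X) (h.trans (card_codeSegment X).symm)

theorem codeSegment_subset_codeSegment {k : ℕ} {X Y : Finset (Fin k → ℕ)} (h : X.card ≤ Y.card) :
    codeSegment X ⊆ codeSegment Y :=
  (codeSegment_isCodeInitial X).subset_of_card_le (codeSegment_isCodeInitial Y)
    (by rwa [card_codeSegment, card_codeSegment])

/-! ### The weight counting zero coordinates -/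

/-- The contribution of the coordinate value `a` to `zeroWeight`. -/
def zeroFactor (a : ℕ) : ℕ := if a = 0 then 3 else 1

/-- Three to the power of the number of zero coordinates of `x`. -/
def zeroWeight {k : ℕ} (x : Fin k → ℕ) : ℕ := ∏ i, zeroFactor (x i)

theorem one_le_zeroFactor (a : ℕ) : 1 ≤ zeroFactor a := by
  unfold zeroFactor; split_ifs <;> norm_num

theorem zeroFactor_le_three (a : ℕ) : zeroFactor a ≤ 3 := by
  unfold zeroFactor; split_ifs <;> norm_num

theorem one_le_zeroWeight {k : ℕ} (x : Fin k → ℕ) : 1 ≤ zeroWeight x :=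
  Nat.succ_le_of_lt (Finset.prod_pos fun i _ => one_le_zeroFactor (x i))

theorem zeroWeight_insertNth {k : ℕ} (p : Fin (k + 1)) (t : ℕ) (w : Fin k → ℕ) :
    zeroWeight (p.insertNth t w : Fin (k + 1) → ℕ) = zeroFactor t * zeroWeight w := by
  simp [zeroWeight, Fin.prod_univ_succAbove _ p]

theorem zeroWeight_eq_zeroFactor {k : ℕ} {x : Fin k → ℕ} (p : Fin k) (h : ∀ i, i ≠ p → x i ≠ 0) :
    zeroWeight x = zeroFactor (x p) :=
  Finset.prod_eq_single p (fun i _ hi => if_neg (h i hi)) (by simp)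

theorem three_le_zeroWeight {k : ℕ} {x : Fin k → ℕ} {p : Fin k} (h : x p = 0) :
    3 ≤ zeroWeight x := by
  obtain ⟨k, rfl⟩ := Nat.exists_eq_succ_of_ne_zero p.pos.ne'
  rw [← Fin.insertNth_self_removeNth p x, zeroWeight_insertNth, h]
  have := one_le_zeroWeight (p.removeNth x)
  simp only [zeroFactor]
  simp
  omega

/-! ### Slices and compression -/

/-- The slice of `X` consisting of its points with `p`-th coordinate `t`, that coordinate
deleted. -/
noncomputable def slice {k : ℕ} (p : Fin (k + 1)) (t : ℕ) (X : Finset (Fin (k + 1) → ℕ)) : Finset (Fin k → ℕ) :=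
  X.preimage (fun w => (p.insertNth t w : Fin (k + 1) → ℕ))
    fun _ _ _ _ h => (Fin.insertNth_inj.1 h).2

theorem mem_slice {k : ℕ} {p : Fin (k + 1)} {t : ℕ} {X : Finset (Fin (k + 1) → ℕ)}
    {w : Fin k → ℕ} : w ∈ slice p t X ↔ (p.insertNth t w : Fin (k + 1) → ℕ) ∈ X :=
  Finset.mem_preimage

theorem removeNth_mem_slice {k : ℕ} {p : Fin (k + 1)} {X : Finset (Fin (k + 1) → ℕ)}
    {x : Fin (k + 1) → ℕ} : p.removeNth x ∈ slice p (x p) X ↔ x ∈ X := by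
  rw [mem_slice, Fin.insertNth_self_removeNth]

theorem sum_eq_sum_slice {k : ℕ} (p : Fin (k + 1)) (X : Finset (Fin (k + 1) → ℕ)) (T : Finset ℕ)
    (hT : ∀ x ∈ X, x p ∈ T) (φ : (Fin (k + 1) → ℕ) → ℕ) :
    ∑ x ∈ X, φ x = ∑ t ∈ T, ∑ w ∈ slice p t X, φ (p.insertNth t w) := by
  rw [← Finset.sum_fiberwise_of_maps_to hT]
  refine Finset.sum_congr rfl fun t _ => ?_
  symm
  refine Finset.sum_nbij' (fun w => (p.insertNth t w : Fin (k + 1) → ℕ)) (fun x => p.removeNth x)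
    ?_ ?_ ?_ ?_ ?_
  · intro w hw
    simpa using mem_slice.1 hw
  · intro x hx
    obtain ⟨hx', rfl⟩ := Finset.mem_filter.1 hx
    exact removeNth_mem_slice.2 hx'
  · intro w _
    simp
  · intro x hx
    obtain ⟨hx, rfl⟩ := Finset.mem_filter.1 hx
    simp
  · intro w _
    rfl

theorem card_eq_sum_card_slice {k : ℕ} (p : Fin (k + 1)) (X : Finset (Fin (k + 1) → ℕ))
    (T : Finset ℕ) (hT : ∀ x ∈ X, x p ∈ T) : X.card = ∑ t ∈ T, (slice p t X).card := by
  simpa using sum_eq_sum_slice p X T hT fun _ => 1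

theorem insertNth_le_insertNth {k : ℕ} {p : Fin (k + 1)} {s t : ℕ} {u v : Fin k → ℕ}
    (hst : s ≤ t) (huv : u ≤ v) :
    (p.insertNth s u : Fin (k + 1) → ℕ) ≤ (p.insertNth t v : Fin (k + 1) → ℕ) := by
  rw [Fin.insertNth_le_iff]
  simpa using ⟨hst, huv⟩

theorem isLowerSet_slice {k : ℕ} {X : Finset (Fin (k + 1) → ℕ)}
    (hX : IsLowerSet (X : Set (Fin (k + 1) → ℕ))) (p : Fin (k + 1)) (t : ℕ) :
    IsLowerSet (slice p t X : Set (Fin k → ℕ)) := by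
  intro v u huv hv
  rw [Finset.mem_coe, mem_slice] at hv ⊢
  exact hX (insertNth_le_insertNth le_rfl huv) hv

theorem slice_subset_slice {k : ℕ} {X : Finset (Fin (k + 1) → ℕ)}
    (hX : IsLowerSet (X : Set (Fin (k + 1) → ℕ))) (p : Fin (k + 1)) {s t : ℕ} (hst : s ≤ t) :
    slice p t X ⊆ slice p s X := by
  intro w hw
  rw [mem_slice] at hw ⊢
  exact hX (insertNth_le_insertNth hst le_rfl) hw

/-- The set obtained from `X` by replacing each slice in direction `p` by the initial segment of
the same size. -/
noncomputable def sliceCompress {k : ℕ} (p : Fin (k + 1)) (X : Finset (Fin (k + 1) → ℕ)) :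
    Finset (Fin (k + 1) → ℕ) :=
  (X.image fun x => x p).biUnion fun t =>
    (codeSegment (slice p t X)).image fun w => p.insertNth t w

theorem slice_sliceCompress {k : ℕ} (p : Fin (k + 1)) (t : ℕ) (X : Finset (Fin (k + 1) → ℕ)) :
    slice p t (sliceCompress p X) = codeSegment (slice p t X) := by
  ext w
  simp only [mem_slice, sliceCompress, Finset.mem_biUnion, Finset.mem_image]
  constructor
  · rintro ⟨s, -, v, hv, h⟩
    obtain ⟨rfl, rfl⟩ := Fin.insertNth_inj.1 h
    exact hv
  · intro hw
    have hne : (slice p t X).Nonempty := by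
      rw [← Finset.card_pos, ← card_codeSegment]
      exact Finset.card_pos.2 ⟨w, hw⟩
    obtain ⟨v, hv⟩ := hne
    exact ⟨t, ⟨_, mem_slice.1 hv, by simp⟩, w, hw, rfl⟩

theorem mem_sliceCompress {k : ℕ} {p : Fin (k + 1)} {X : Finset (Fin (k + 1) → ℕ)}
    {x : Fin (k + 1) → ℕ} :
    x ∈ sliceCompress p X ↔ p.removeNth x ∈ codeSegment (slice p (x p) X) := by
  rw [← slice_sliceCompress, removeNth_mem_slice]

theorem apply_mem_of_mem_sliceCompress {k : ℕ} {p : Fin (k + 1)} {X : Finset (Fin (k + 1) → ℕ)} :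
    ∀ x ∈ sliceCompress p X, x p ∈ X.image fun x => x p := by
  intro x hx
  simp only [sliceCompress, Finset.mem_biUnion] at hx
  obtain ⟨t, ht, hx⟩ := hx
  obtain ⟨w, -, rfl⟩ := Finset.mem_image.1 hx
  simpa using ht

theorem card_sliceCompress {k : ℕ} (p : Fin (k + 1)) (X : Finset (Fin (k + 1) → ℕ)) :
    (sliceCompress p X).card = X.card := by
  rw [card_eq_sum_card_slice p _ _ apply_mem_of_mem_sliceCompress,
    card_eq_sum_card_slice p X _ fun x hx => Finset.mem_image_of_mem _ hx]
  simp only [slice_sliceCompress, card_codeSegment]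

/-- Slices of a lower set shrink as the height grows, and initial segments are nested according to
size. -/
theorem isLowerSet_sliceCompress {k : ℕ} {X : Finset (Fin (k + 1) → ℕ)}
    (hX : IsLowerSet (X : Set (Fin (k + 1) → ℕ))) (p : Fin (k + 1)) :
    IsLowerSet (sliceCompress p X : Set (Fin (k + 1) → ℕ)) := by
  intro x y hyx hx
  rw [Finset.mem_coe, mem_sliceCompress] at hx ⊢
  have h1 := codeSegment_subset_codeSegment
    (Finset.card_le_card (slice_subset_slice hX p (hyx p))) hx
  exact (codeSegment_isCodeInitial _).isLowerSet (fun i => hyx _) h1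

theorem sum_zeroWeight_sliceCompress_le {k : ℕ} {X : Finset (Fin (k + 1) → ℕ)} (p : Fin (k + 1))
    (h : ∀ t, ∑ w ∈ codeSegment (slice p t X), zeroWeight w ≤ ∑ w ∈ slice p t X, zeroWeight w) :
    ∑ x ∈ sliceCompress p X, zeroWeight x ≤ ∑ x ∈ X, zeroWeight x := by
  rw [sum_eq_sum_slice p _ _ apply_mem_of_mem_sliceCompress,
    sum_eq_sum_slice p X _ fun x hx => Finset.mem_image_of_mem _ hx]
  refine Finset.sum_le_sum fun t _ => ?_
  simp only [slice_sliceCompress, zeroWeight_insertNth, ← Finset.mul_sum]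
  exact Nat.mul_le_mul_left _ (h t)

theorem sum_vecCode_sliceCompress_lt {k : ℕ} {X : Finset (Fin (k + 1) → ℕ)} {p : Fin (k + 1)}
    {t : ℕ} (h : ¬ IsCodeInitial (slice p t X)) :
    ∑ x ∈ sliceCompress p X, vecCode x < ∑ x ∈ X, vecCode x := by
  have key : ∀ s, codeSegment (slice p s X) ≠ slice p s X →
      ∑ w ∈ codeSegment (slice p s X), vecCode (p.insertNth s w : Fin (k + 1) → ℕ) <
        ∑ w ∈ slice p s X, vecCode (p.insertNth s w : Fin (k + 1) → ℕ) := fun s hs =>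
    (codeSegment_isCodeInitial _).sum_lt_sum (card_codeSegment _) hs
      fun u v => vecCode_insertNth_lt_of_lt p s
  have hne : codeSegment (slice p t X) ≠ slice p t X :=
    fun h' => h (h' ▸ codeSegment_isCodeInitial _)
  rw [sum_eq_sum_slice p _ _ apply_mem_of_mem_sliceCompress,
    sum_eq_sum_slice p X _ fun x hx => Finset.mem_image_of_mem _ hx]
  simp only [slice_sliceCompress]
  refine Finset.sum_lt_sum (fun s _ => ?_) ⟨t, ?_, key t hne⟩
  · by_cases hs : codeSegment (slice p s X) = slice p s X
    · rw [hs]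
    · exact (key s hs).le
  · by_contra ht
    refine h fun v hv => ?_
    exact absurd (Finset.mem_image.2 ⟨_, mem_slice.1 hv, by simp⟩) ht

/-! ### Exchanges and the minimum over lower sets -/

/-- Replacing a set of points of a lower set by equally many points of smaller code decreases the
sum of codes. -/
theorem exists_sum_vecCode_lt_of_exchange {k : ℕ} {X A B : Finset (Fin k → ℕ)} (hA : A ⊆ X)
    (hB : ∀ b ∈ B, b ∉ X) (hcard : A.card = B.card) (hne : A.Nonempty)
    (hAB : ∀ b ∈ B, ∀ a ∈ A, vecCode b < vecCode a)
    (hweight : ∑ x ∈ B, zeroWeight x ≤ ∑ x ∈ A, zeroWeight x)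
    (hAlower : ∀ w ∈ X, w ∉ A → ∀ u ≤ w, u ∉ A)
    (hBlower : ∀ b ∈ B, ∀ w ≤ b, w ∉ B → w ∈ X)
    (hX : IsLowerSet (X : Set (Fin k → ℕ))) :
    ∃ Y : Finset (Fin k → ℕ), IsLowerSet (Y : Set (Fin k → ℕ)) ∧ Y.card = X.card ∧
      ∑ x ∈ Y, zeroWeight x ≤ ∑ x ∈ X, zeroWeight x ∧
      ∑ x ∈ Y, vecCode x < ∑ x ∈ X, vecCode x := by
  have hdisj : Disjoint (X \ A) B :=
    Finset.disjoint_left.2 fun x hx hxB => hB x hxB (Finset.mem_sdiff.1 hx).1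
  have hsum (φ : (Fin k → ℕ) → ℕ) : ∑ x ∈ X, φ x = ∑ x ∈ X \ A, φ x + ∑ x ∈ A, φ x :=
    (Finset.sum_sdiff hA).symm
  refine ⟨X \ A ∪ B, ?_, ?_, ?_, ?_⟩
  · intro w u huw hw
    rw [Finset.mem_coe, Finset.mem_union, Finset.mem_sdiff] at hw ⊢
    by_cases huB : u ∈ B
    · exact Or.inr huB
    left
    rcases hw with ⟨hwX, hwA⟩ | hwB
    · exact ⟨hX huw hwX, hAlower w hwX hwA u huw⟩
    · refine ⟨hBlower w hwB u huw huB, fun huA => ?_⟩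
      exact (hAB w hwB u huA).not_ge (vecCode_le_of_le huw)
  · rw [Finset.card_union_of_disjoint hdisj, ← hcard, Finset.card_sdiff_add_card_eq_card hA]
  · rw [Finset.sum_union hdisj, hsum]
    exact Nat.add_le_add_left hweight _
  · rw [Finset.sum_union hdisj, hsum]
    refine Nat.add_lt_add_left ?_ _
    have e := Finset.equivOfCardEq hcard
    rw [← Finset.sum_coe_sort A, ← Finset.sum_coe_sort B, ← Equiv.sum_comp e]
    have : Nonempty ↥A := hne.to_subtype
    exact Finset.sum_lt_sum_of_nonempty Finset.univ_nonempty fun a _ => hAB _ (e a).2 _ a.2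

theorem sum_zeroWeight_image_update {k : ℕ} {x : Fin k → ℕ} (r : Fin k)
    (h : ∀ j, j ≠ r → x j ≠ 0) (n : ℕ) :
    ∑ z ∈ (Finset.range n).image (Function.update x r), zeroWeight z =
      ∑ s ∈ Finset.range n, zeroFactor s := by
  rw [Finset.sum_image (Function.update_injective x r).injOn]
  refine Finset.sum_congr rfl fun s _ => ?_
  rw [zeroWeight_eq_zeroFactor r, Function.update_self]
  intro j hj
  rw [Function.update_of_ne hj]
  exact h j hj

/-- A finite lower set all of whose slices are initial segments, but which is not an initial
segment itself, can be improved by an exchange. -/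
theorem exists_sum_vecCode_lt_of_slices_isCodeInitial {k : ℕ} {X : Finset (Fin (k + 1) → ℕ)}
    (hX : IsLowerSet (X : Set (Fin (k + 1) → ℕ)))
    (hslice : ∀ p t, IsCodeInitial (slice p t X)) (hinit : ¬ IsCodeInitial X) :
    ∃ Y : Finset (Fin (k + 1) → ℕ), IsLowerSet (Y : Set (Fin (k + 1) → ℕ)) ∧ Y.card = X.card ∧
      ∑ x ∈ Y, zeroWeight x ≤ ∑ x ∈ X, zeroWeight x ∧
      ∑ x ∈ Y, vecCode x < ∑ x ∈ X, vecCode x := by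
  -- Points sharing a coordinate lie in a common slice, which is an initial segment.
  have hstable : ∀ x ∈ X, ∀ y, vecCode y < vecCode x → ∀ p, x p = y p → y ∈ X := by
    intro x hx y hyx p hp
    rw [← removeNth_mem_slice (p := p)]
    rw [← removeNth_mem_slice (p := p), hp] at hx
    refine hslice p _ _ hx _ ?_
    rw [← vecCode_insertNth_lt_iff p (y p), Fin.insertNth_self_removeNth]
    rwa [← hp, Fin.insertNth_self_removeNth]
  simp only [IsCodeInitial, not_forall] at hinit
  obtain ⟨v, hv, u, huv, hu⟩ := hinit
  obtain ⟨x, hx, hxmax⟩ := X.exists_max_image vecCode ⟨v, hv⟩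
  obtain ⟨y, hy, hymin⟩ := (measure (vecCode : (Fin (k + 1) → ℕ) → ℕ)).wf.has_min
    ((X : Set (Fin (k + 1) → ℕ))ᶜ) ⟨u, hu⟩
  replace hymin : ∀ w, vecCode w < vecCode y → w ∈ X := fun w hw =>
    by_contra fun hwX => hymin w hwX hw
  replace hy : y ∉ X := hy
  have hyx : vecCode y < vecCode x := by
    refine lt_of_le_of_lt ?_ (huv.trans_le (hxmax v hv))
    by_contra h
    exact hu (hymin u (not_le.1 h))
  have hxmem : ∀ w ∈ X, w ≠ x → vecCode w < vecCode x := fun w hw hwx =>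
    lt_of_le_of_ne (hxmax w hw) fun h => hwx (vecCode_injective h)
  have hdiff : ∀ j, y j ≠ x j := fun j hj => hy (hstable x hx y hyx j hj.symm)
  obtain ⟨i, -, hi⟩ := vecCode_lt_iff.1 hyx
  replace hi : ∀ j, y j < x i ∨ (y j = x i ∧ i < j) := fun j => hi j (hdiff j)
  have hyi : y i < x i := by
    rcases hi i with h | h
    · exact h
    · exact absurd h.2 (lt_irrefl _)
  -- Otherwise lowering `x j` to `y j` stays in `X` and keeps the decisive entry `x i`. The new
  -- point still has larger code than `y` and shares a coordinate with it, forcing `y ∈ X`.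
  have hxy : ∀ j, j ≠ i → x j < y j := by
    intro j hj
    by_contra hlt
    have hyj : y j < x j := lt_of_le_of_ne (not_lt.1 hlt) (hdiff j)
    have hz : Function.update x j (y j) ∈ X := by
      refine hX ?_ hx
      rw [update_le_iff]
      exact ⟨hyj.le, fun _ _ => le_rfl⟩
    refine hy (hstable _ hz y ?_ j (by simp))
    refine vecCode_lt_iff.2 ⟨i, ?_, fun l _ => ?_⟩
    · rw [Function.update_of_ne hj.symm]
      exact hdiff i
    · rw [Function.update_of_ne hj.symm]
      exact hi l
  by_cases hw : zeroWeight y ≤ zeroWeight x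
  · refine exists_sum_vecCode_lt_of_exchange (X := X) (A := {x}) (B := {y}) (by simpa) (by simpa)
      rfl (by simp) (by simpa) (by simpa) ?_ ?_ hX
    · intro w hwX hwx u huw hux
      rw [Finset.mem_singleton] at hwx hux
      subst hux
      exact (hxmem w hwX hwx).not_ge (vecCode_le_of_le huw)
    · intro b hb w hwb hwy
      rw [Finset.mem_singleton] at hb hwy
      subst hb
      exact hymin w (lt_of_le_of_ne (vecCode_le_of_le hwb) fun h => hwy (vecCode_injective h))
  -- In the remaining case `y` has exactly one zero, at `i`, and `x` has none: the weights are `3`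
  -- and `1`, so the single swap would raise the weight.
  have hy0 : ∀ j, j ≠ i → y j ≠ 0 := fun j hj => (Nat.zero_le _ |>.trans_lt (hxy j hj)).ne'
  have hwy := zeroWeight_eq_zeroFactor i hy0
  have hyi0 : y i = 0 := by
    by_contra h
    rw [hwy, zeroFactor, if_neg h] at hw
    exact hw (one_le_zeroWeight x)
  have hx0 : ∀ j, x j ≠ 0 := fun j hj =>
    hw ((hwy.le.trans (zeroFactor_le_three _)).trans (three_le_zeroWeight hj))
  obtain ⟨r, hr⟩ := Finite.exists_min x
  obtain ⟨j₀, hj₀⟩ : ∃ j, j ≠ i := by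
    by_contra! h
    refine hy (hX (fun j => ?_) hx)
    rw [h j]
    exact hyi.le
  have hyle : ∀ j, y j ≤ x i := fun j => by
    rcases hi j with h | h
    · exact h.le
    · exact h.1.le
  have hri : r ≠ i := by
    rintro rfl
    exact (hr j₀).not_gt ((hxy j₀ hj₀).trans_le (hyle j₀))
  have hrlt : x r < x i := (hxy r hri).trans_le (hyle r)
  have hBA : ∀ s ≤ x r, ∀ t, vecCode (Function.update y i s) < vecCode (Function.update x r t) := by
    intro s hs t
    refine vecCode_lt_iff.2 ⟨i, ?_, fun j _ => ?_⟩
    · rw [Function.update_self, Function.update_of_ne hri.symm]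
      omega
    · rw [Function.update_of_ne hri.symm]
      rcases eq_or_ne j i with rfl | hj
      · rw [Function.update_self]
        left
        omega
      · rw [Function.update_of_ne hj]
        exact hi j
  have hyup : Function.update y i 0 = y := by rw [← hyi0, Function.update_eq_self]
  have hxup : Function.update x r (x r) = x := Function.update_eq_self r x
  -- Exchange two lines of length `x r + 1`, each starting at height `0`: one runs down from `x` in
  -- direction `r`, the other up from `y` in direction `i`. Apart from the moving coordinate all
  -- entries are nonzero, so the two weights agree.
  refine exists_sum_vecCode_lt_of_exchange (X := X)
    (A := (Finset.range (x r + 1)).image (Function.update x r))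
    (B := (Finset.range (x r + 1)).image (Function.update y i)) ?_ ?_ ?_ (by simp) ?_ ?_ ?_ ?_ hX
  · intro a ha
    obtain ⟨s, hs, rfl⟩ := Finset.mem_image.1 ha
    refine hX (update_le_iff.2 ⟨?_, fun _ _ => le_rfl⟩) hx
    exact Nat.lt_succ_iff.1 (Finset.mem_range.1 hs)
  · intro b hb hbX
    obtain ⟨s, hs, rfl⟩ := Finset.mem_image.1 hb
    refine hy (hX (le_update_iff.2 ⟨?_, fun _ _ => le_rfl⟩) hbX)
    omega
  · rw [Finset.card_image_of_injective _ (Function.update_injective x r),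
      Finset.card_image_of_injective _ (Function.update_injective y i)]
  · intro b hb a ha
    obtain ⟨s, hs, rfl⟩ := Finset.mem_image.1 hb
    obtain ⟨t, -, rfl⟩ := Finset.mem_image.1 ha
    exact hBA s (Nat.lt_succ_iff.1 (Finset.mem_range.1 hs)) t
  · rw [sum_zeroWeight_image_update r fun j _ => hx0 j, sum_zeroWeight_image_update i hy0]
  · intro w hw hwA u huw hu
    obtain ⟨s, hs, rfl⟩ := Finset.mem_image.1 hu
    rw [update_le_iff] at huw
    have hwx : w ≠ x := by
      rintro rfl
      exact hwA (Finset.mem_image.2 ⟨_, Finset.self_mem_range_succ _, hxup⟩)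
    -- Off `r` the point `w` is at least `x`, so the decisive index is `r`. Any other entry where
    -- they differ would exceed some `x j ≥ x r`, yet the comparison bounds it by `x r`; this is
    -- where minimality of `x r` enters.
    obtain ⟨l, hl, h⟩ := vecCode_lt_iff.1 (hxmem w hw hwx)
    have hlr : l = r := by
      by_contra hlr
      have h1 := huw.2 l hlr
      have h2 := h l hl
      simp only [lt_irrefl, and_false, or_false] at h2
      omega
    subst hlr
    have h2 := h l hl
    simp only [lt_irrefl, and_false, or_false] at h2
    refine hwA (Finset.mem_image.2 ⟨w l, Finset.mem_range.2 (by omega), ?_⟩)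
    rw [Function.update_eq_iff]
    refine ⟨rfl, fun j hj => ?_⟩
    by_contra hne
    have h1 := huw.2 j hj
    have h3 := h j (Ne.symm hne)
    have h4 := hr j
    omega
  · intro b hb w hwb hwB
    obtain ⟨s, hs, rfl⟩ := Finset.mem_image.1 hb
    rw [Finset.mem_range] at hs
    rw [le_update_iff] at hwb
    refine hymin w ?_
    rcases lt_trichotomy (vecCode w) (vecCode y) with h | h | h
    · exact h
    · refine absurd (Finset.mem_image.2 ⟨0, by simp, ?_⟩) hwB
      rw [hyup, vecCode_injective h]
    exfalso
    -- Dually, the decisive index must be `i`, and an entry differing elsewhere would give `y j ≤ w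
    -- i ≤ x r ≤ x j < y j`.
    obtain ⟨l, hl, h⟩ := vecCode_lt_iff.1 h
    have h2 := h l hl
    simp only [lt_irrefl, and_false, or_false] at h2
    have hli : l = i := by
      by_contra hli
      have h1 := hwb.2 l hli
      omega
    subst hli
    refine hwB (Finset.mem_image.2 ⟨w l, Finset.mem_range.2 (by omega), ?_⟩)
    rw [Function.update_eq_iff]
    refine ⟨rfl, fun j hj => ?_⟩
    by_contra hne
    have h3 := h j hne
    have h4 := hr j
    have h5 := hxy j hj
    omega

/-- Among the finite lower sets of a given size, the initial segment has the least weight. -/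
theorem sum_zeroWeight_codeSegment_le_of_isLowerSet (k : ℕ) :
    ∀ X : Finset (Fin k → ℕ), IsLowerSet (X : Set (Fin k → ℕ)) →
      ∑ x ∈ codeSegment X, zeroWeight x ≤ ∑ x ∈ X, zeroWeight x := by
  induction k with
  | zero =>
    intro X _
    have hX : IsCodeInitial X := fun v hv u _ => Subsingleton.elim v u ▸ hv
    rw [← hX.eq_codeSegment rfl]
  | succ k ih =>
    intro X
    -- The sum of codes strictly drops under both compression and exchange, so the improvement
    -- process terminates.
    induction hn : ∑ x ∈ X, vecCode x using Nat.strong_induction_on generalizing X with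
    | _ n ihn =>
      intro hX
      by_cases hinit : IsCodeInitial X
      · rw [← hinit.eq_codeSegment rfl]
      obtain ⟨Y, hY, hcard, hweight, hcode⟩ : ∃ Y : Finset (Fin (k + 1) → ℕ),
          IsLowerSet (Y : Set (Fin (k + 1) → ℕ)) ∧ Y.card = X.card ∧
          ∑ x ∈ Y, zeroWeight x ≤ ∑ x ∈ X, zeroWeight x ∧
          ∑ x ∈ Y, vecCode x < ∑ x ∈ X, vecCode x := by
        by_cases hslice : ∀ p t, IsCodeInitial (slice p t X)
        · exact exists_sum_vecCode_lt_of_slices_isCodeInitial hX hslice hinit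
        · simp only [not_forall] at hslice
          obtain ⟨p, t, hpt⟩ := hslice
          exact ⟨sliceCompress p X, isLowerSet_sliceCompress hX p, card_sliceCompress p X,
            sum_zeroWeight_sliceCompress_le p fun t => ih _ (isLowerSet_slice hX p t),
            sum_vecCode_sliceCompress_lt hpt⟩
      have h := ihn _ (hn ▸ hcode) Y rfl hY
      rw [← (codeSegment_isCodeInitial X).eq_codeSegment
        ((card_codeSegment X).trans hcard.symm)] at h
      exact h.trans hweight

/-! ### Projection sums of arbitrary sets -/

/-- The projection of `X` in which the coordinates selected by `b` are replaced by `0`. -/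
def zeroCoords {k : ℕ} (b : Fin k → Bool) (X : Finset (Fin k → ℕ)) : Finset (Fin k → ℕ) :=
  X.image fun x i => if b i then 0 else x i

/-- The sum of the sizes of all coordinate projections of `X`, each weighted by two to the power
of the number of deleted coordinates. -/
def natProjectionSum {k : ℕ} (X : Finset (Fin k → ℕ)) : ℕ :=
  ∑ b : Fin k → Bool, (∏ i, if b i then 2 else 1) * (zeroCoords b X).card

theorem zeroCoords_eq_filter {k : ℕ} {X : Finset (Fin k → ℕ)}
    (hX : IsLowerSet (X : Set (Fin k → ℕ))) (b : Fin k → Bool) :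
    zeroCoords b X = {x ∈ X | ∀ i, b i → x i = 0} := by
  ext y
  simp only [zeroCoords, Finset.mem_image, Finset.mem_filter]
  constructor
  · rintro ⟨x, hx, rfl⟩
    refine ⟨hX (fun i => ?_) hx, fun i hi => if_pos hi⟩
    dsimp only
    split_ifs
    · exact Nat.zero_le _
    · exact le_rfl
  · rintro ⟨hy, h⟩
    refine ⟨y, hy, funext fun i => ?_⟩
    split_ifs with hi
    · exact (h i hi).symm
    · rfl

/-- Exchange the two sums: a point is counted for those `b` selecting only its zeros, and each zero
contributes the factor `1 + 2 = 3`. -/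
theorem natProjectionSum_eq_sum_zeroWeight {k : ℕ} {X : Finset (Fin k → ℕ)}
    (hX : IsLowerSet (X : Set (Fin k → ℕ))) :
    natProjectionSum X = ∑ x ∈ X, zeroWeight x := by
  have key (x : Fin k → ℕ) (b : Fin k → Bool) :
      (∏ i, if b i then 2 else 1) * (if ∀ i, b i → x i = 0 then 1 else 0) =
        ∏ i, if b i then (if x i = 0 then 2 else 0) else 1 := by
    split_ifs with h
    · rw [mul_one]
      refine Finset.prod_congr rfl fun i _ => ?_
      by_cases hb : b i
      · simp [hb, h i hb]
      · simp [hb]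
    · push Not at h
      obtain ⟨i, hb, hx⟩ := h
      rw [mul_zero, Finset.prod_eq_zero (Finset.mem_univ i)]
      simp [hb, hx]
  have hweight (x : Fin k → ℕ) : zeroWeight x =
      ∑ b : Fin k → Bool, ∏ i, if b i then (if x i = 0 then 2 else 0) else 1 := by
    have h := Finset.prod_univ_sum (fun _ : Fin k => (Finset.univ : Finset Bool))
      fun i b => if b = true then (if x i = 0 then 2 else 0) else 1
    rw [Fintype.piFinset_univ] at h
    rw [← h]
    refine Finset.prod_congr rfl fun i _ => ?_
    by_cases hx : x i = 0 <;> simp [zeroFactor, hx]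
  simp only [hweight, ← key]
  rw [Finset.sum_comm, natProjectionSum]
  refine Finset.sum_congr rfl fun b _ => ?_
  rw [zeroCoords_eq_filter hX, ← Finset.mul_sum, Finset.card_filter]

theorem slice_zeroCoords {k : ℕ} (b : Fin k → Bool) (t : ℕ) (X : Finset (Fin (k + 1) → ℕ)) :
    slice 0 t (zeroCoords (Fin.cons false b : Fin (k + 1) → Bool) X) =
      zeroCoords b (slice 0 t X) := by
  ext w
  simp only [mem_slice, zeroCoords, Finset.mem_image, Fin.insertNth_zero']
  constructor
  · rintro ⟨x, hx, h⟩
    refine ⟨Fin.tail x, ?_, funext fun i => by simpa [Fin.tail] using congrFun h i.succ⟩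
    have h0 : x 0 = t := by simpa using congrFun h 0
    rwa [← h0, Fin.cons_self_tail]
  · rintro ⟨v, hv, rfl⟩
    refine ⟨_, hv, funext fun i => ?_⟩
    refine Fin.cases ?_ (fun i => ?_) i <;> simp

theorem card_zeroCoords_cons_true {k : ℕ} (b : Fin k → Bool) (X : Finset (Fin (k + 1) → ℕ)) :
    (zeroCoords (Fin.cons true b : Fin (k + 1) → Bool) X).card =
      (zeroCoords b (X.image Fin.tail)).card := by
  have h : zeroCoords (Fin.cons true b : Fin (k + 1) → Bool) X =
      (zeroCoords b (X.image Fin.tail)).image (Fin.cons (α := fun _ => ℕ) 0) := by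
    simp only [zeroCoords, Finset.image_image]
    refine Finset.image_congr fun x _ => funext fun i => ?_
    refine Fin.cases ?_ (fun i => ?_) i <;> simp [Fin.tail]
  rw [h, Finset.card_image_of_injective _ (Fin.cons_right_injective (α := fun _ => ℕ) 0)]

/-- If coordinate `0` is kept, the projection splits into the projections of the slices. If it is
deleted, it contributes the factor `2` and leaves a projection of the image under `Fin.tail`. -/
theorem natProjectionSum_succ {k : ℕ} (X : Finset (Fin (k + 1) → ℕ)) :
    natProjectionSum X = ∑ t ∈ X.image (fun x => x 0), natProjectionSum (slice 0 t X) +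
      2 * natProjectionSum (X.image Fin.tail) := by
  have hcard (b : Fin k → Bool) :
      (zeroCoords (Fin.cons false b : Fin (k + 1) → Bool) X).card =
        ∑ t ∈ X.image (fun x => x 0), (zeroCoords b (slice 0 t X)).card := by
    rw [card_eq_sum_card_slice 0 _ (X.image fun x => x 0)]
    · simp only [slice_zeroCoords]
    · intro y hy
      obtain ⟨x, hx, rfl⟩ := Finset.mem_image.1 hy
      exact Finset.mem_image.2 ⟨x, hx, by simp⟩
  have hcons (c : Bool) (b : Fin k → Bool) :
      (Fin.consEquiv fun _ : Fin (k + 1) => Bool) (c, b) = Fin.cons c b := rfl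
  unfold natProjectionSum
  rw [← (Fin.consEquiv fun _ => Bool).sum_comp, Fintype.sum_prod_type, Fintype.sum_bool, add_comm,
    Finset.sum_comm (s := X.image _)]
  simp only [hcons, Fin.prod_univ_succ, Fin.cons_zero, Fin.cons_succ, hcard,
    card_zeroCoords_cons_true, Finset.mul_sum]
  simp [mul_assoc]

/-- A nonempty column has one zero of weight `3`, which gives equality. The excess `2` matches the
coefficient of the deleted coordinate in `natProjectionSum_succ`. -/
theorem sum_range_zeroFactor_le (n : ℕ) : ∑ s ∈ Finset.range n, zeroFactor s ≤ n + 2 := by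
  induction n with
  | zero => simp
  | succ n ih =>
    rcases n with _ | n
    · simp [zeroFactor]
    · rw [Finset.sum_range_succ, zeroFactor, if_neg (Nat.succ_ne_zero n)]
      omega

/-- Among all finite sets of a given size, the initial segment has the least sum of projections. -/
theorem sum_zeroWeight_codeSegment_le_natProjectionSum (k : ℕ) :
    ∀ X : Finset (Fin k → ℕ), ∑ x ∈ codeSegment X, zeroWeight x ≤ natProjectionSum X := by
  induction k with
  | zero =>
    intro X
    have hX : IsLowerSet (X : Set (Fin 0 → ℕ)) := fun v u _ hv => Subsingleton.elim v u ▸ hv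
    rw [natProjectionSum_eq_sum_zeroWeight hX]
    exact sum_zeroWeight_codeSegment_le_of_isLowerSet 0 X hX
  | succ k ih =>
    intro X
    set T := X.image fun x => x 0
    set U := codeSegment (X.image (Fin.tail (α := fun _ => ℕ)))
    have hsub (t : ℕ) : codeSegment (slice 0 t X) ⊆ U := by
      refine codeSegment_subset_codeSegment (Finset.card_le_card fun w hw => ?_)
      rw [mem_slice, Fin.insertNth_zero'] at hw
      exact Finset.mem_image.2 ⟨_, hw, Fin.tail_cons _ _⟩
    let h (w : Fin k → ℕ) : ℕ := {t ∈ T | w ∈ codeSegment (slice 0 t X)}.card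
    have hh (φ : (Fin k → ℕ) → ℕ) :
        ∑ w ∈ U, h w * φ w = ∑ t ∈ T, ∑ w ∈ codeSegment (slice 0 t X), φ w := by
      have h1 (t : ℕ) : ∑ w ∈ codeSegment (slice 0 t X), φ w =
          ∑ w ∈ U, if w ∈ codeSegment (slice 0 t X) then φ w else 0 := by
        rw [← Finset.sum_filter, Finset.filter_mem_eq_inter, Finset.inter_eq_right.2 (hsub t)]
      simp only [h1]
      rw [Finset.sum_comm]
      refine Finset.sum_congr rfl fun w _ => ?_
      rw [← Finset.sum_filter, Finset.sum_const, smul_eq_mul]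
    -- Compress every slice to an initial segment, then push each column down; `h w` is the number
    -- of compressed slices containing `w`.
    let Y : Finset (Fin (k + 1) → ℕ) := (U.sigma fun w => Finset.range (h w)).image
      fun p => (Fin.cons p.2 p.1 : Fin (k + 1) → ℕ)
    have hYsum (φ : (Fin (k + 1) → ℕ) → ℕ) :
        ∑ y ∈ Y, φ y = ∑ w ∈ U, ∑ s ∈ Finset.range (h w), φ (Fin.cons s w) := by
      rw [Finset.sum_image, Finset.sum_sigma]
      rintro ⟨w, s⟩ _ ⟨w', s'⟩ _ heq
      obtain ⟨h1, h2⟩ := Fin.cons_inj.1 heq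
      dsimp only at h1 h2
      subst h1 h2
      rfl
    have hmem (y : Fin (k + 1) → ℕ) : y ∈ Y ↔ Fin.tail y ∈ U ∧ y 0 < h (Fin.tail y) := by
      simp only [Y, Finset.mem_image, Finset.mem_sigma, Finset.mem_range]
      constructor
      · rintro ⟨p, hp, rfl⟩
        simpa using hp
      · intro hy
        exact ⟨⟨Fin.tail y, y 0⟩, hy, Fin.cons_self_tail y⟩
    have hYlower : IsLowerSet (Y : Set (Fin (k + 1) → ℕ)) := by
      intro y z hzy hy
      rw [Finset.mem_coe, hmem] at hy ⊢
      have htail : Fin.tail z ≤ Fin.tail y := fun i => hzy i.succ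
      refine ⟨(codeSegment_isCodeInitial _).isLowerSet htail hy.1,
        (hzy 0).trans_lt (hy.2.trans_le (Finset.card_le_card ?_))⟩
      -- A segment containing the larger tail contains the smaller one, so column heights do not
      -- increase with the tail.
      exact Finset.monotone_filter_right _ fun t _ ht =>
        (codeSegment_isCodeInitial _).isLowerSet htail ht
    have hYcard : Y.card = X.card := by
      rw [card_eq_sum_card_slice 0 X T fun x hx => Finset.mem_image_of_mem _ hx,
        Finset.card_eq_sum_ones, hYsum]
      simpa [card_codeSegment] using hh fun _ => 1
    have hYX : codeSegment X = codeSegment Y :=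
      (codeSegment_isCodeInitial X).eq_codeSegment ((card_codeSegment X).trans hYcard.symm)
    rw [hYX]
    refine (sum_zeroWeight_codeSegment_le_of_isLowerSet _ Y hYlower).trans ?_
    rw [hYsum, natProjectionSum_succ]
    calc ∑ w ∈ U, ∑ s ∈ Finset.range (h w), zeroWeight (Fin.cons s w : Fin (k + 1) → ℕ)
        ≤ ∑ w ∈ U, (h w * zeroWeight w + 2 * zeroWeight w) := by
          refine Finset.sum_le_sum fun w _ => ?_
          simp only [← Fin.insertNth_zero', zeroWeight_insertNth, ← Finset.sum_mul, ← add_mul]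
          exact Nat.mul_le_mul_right _ (sum_range_zeroFactor_le _)
      _ = ∑ t ∈ T, ∑ w ∈ codeSegment (slice 0 t X), zeroWeight w +
            2 * ∑ w ∈ U, zeroWeight w := by
          rw [Finset.sum_add_distrib, hh, Finset.mul_sum]
      _ ≤ _ := add_le_add (Finset.sum_le_sum fun t _ => ih _) (Nat.mul_le_mul_left _ (ih _))

theorem natProjectionSum_le_of_isCodeInitial {k : ℕ} {S X : Finset (Fin k → ℕ)}
    (hS : IsCodeInitial S) (h : S.card = X.card) : natProjectionSum S ≤ natProjectionSum X := by
  rw [natProjectionSum_eq_sum_zeroWeight hS.isLowerSet, hS.eq_codeSegment h]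
  exact sum_zeroWeight_codeSegment_le_natProjectionSum k X

/-! ### Transfer to integer vectors -/

theorem intRank_bijective : Function.Bijective intRank := by
  constructor
  · intro a b h
    unfold intRank at h
    split_ifs at h <;> omega
  · intro n
    rcases Nat.even_or_odd' n with ⟨m, rfl | rfl⟩
    · exact ⟨-m, by unfold intRank; split_ifs <;> omega⟩
    · exact ⟨m + 1, by unfold intRank; split_ifs <;> omega⟩

theorem intRank_le_maxEntry {k : ℕ} (u : Fin (k + 1) → ℤ) (j : Fin (k + 1)) :
    intRank (u j) ≤ intRank (maxEntry u) := by
  exact (Finset.mem_filter.1 ((maxIndices u).min'_mem (maxIndices_nonempty u))).2 j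

theorem firstMaxIndex_le {k : ℕ} {u : Fin (k + 1) → ℤ} {j : Fin (k + 1)}
    (h : intRank (u j) = intRank (maxEntry u)) : firstMaxIndex u ≤ j := by
  refine Finset.min'_le _ _ (Finset.mem_filter.2 ?_)
  exact ⟨Finset.mem_univ j, fun l => h ▸ intRank_le_maxEntry u l⟩

/-- The leading binary digit of a code records the maximal entry and its first position. When these
agree, deleting that common coordinate leaves the comparison unchanged. -/
theorem vecCode_lt_of_vecPrec : ∀ {k : ℕ} {u v : Fin k → ℤ}, VecPrec k u v →
    vecCode (fun i => intRank (u i)) < vecCode (fun i => intRank (v i))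
  | 0, _, _, h => h.elim
  | k + 1, u, v, h => by
    rcases h with h | ⟨hM, h | ⟨hi, h⟩⟩
    · have key (j : Fin (k + 1)) : intRank (u j) < intRank (v (firstMaxIndex v)) :=
        (intRank_le_maxEntry u j).trans_lt h
      exact vecCode_lt_iff.2 ⟨firstMaxIndex v, (key _).ne, fun j _ => Or.inl (key j)⟩
    · have hM' : intRank (maxEntry u) = intRank (v (firstMaxIndex v)) := congrArg intRank hM
      refine vecCode_lt_iff.2 ⟨firstMaxIndex v, fun heq => ?_, fun j _ => ?_⟩
      · exact (firstMaxIndex_le (heq.trans hM'.symm)).not_gt h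
      · rcases (intRank_le_maxEntry u j).lt_or_eq with hj | hj
        · exact Or.inl (hj.trans_eq hM')
        · exact Or.inr ⟨hj.trans hM', h.trans_le (firstMaxIndex_le hj)⟩
    · have hinsert (w : Fin (k + 1) → ℤ) : (fun i => intRank (w i)) =
          ((firstMaxIndex w).insertNth (intRank (maxEntry w))
            (fun i => intRank (deleteFirstMax w i)) : Fin (k + 1) → ℕ) := by
        rw [Fin.eq_insertNth_iff]
        exact ⟨rfl, rfl⟩
      rw [hinsert u, hinsert v, ← hi, ← hM]
      exact vecCode_insertNth_lt_of_lt _ _ (vecCode_lt_of_vecPrec h)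

theorem vecPrec_trichotomous : ∀ {k : ℕ} (u v : Fin k → ℤ), VecPrec k u v ∨ u = v ∨ VecPrec k v u
  | 0, u, v => Or.inr (Or.inl (Subsingleton.elim u v))
  | k + 1, u, v => by
    simp only [VecPrec, IntPrec]
    rcases lt_trichotomy (intRank (maxEntry u)) (intRank (maxEntry v)) with h | h | h
    · exact Or.inl (Or.inl h)
    · have hM := intRank_bijective.1 h
      rcases lt_trichotomy (firstMaxIndex v) (firstMaxIndex u) with hi | hi | hi
      · exact Or.inl (Or.inr ⟨hM, Or.inl hi⟩)
      · rcases vecPrec_trichotomous (deleteFirstMax u) (deleteFirstMax v) with hd | hd | hd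
        · exact Or.inl (Or.inr ⟨hM, Or.inr ⟨hi.symm, hd⟩⟩)
        · right
          left
          rw [← Fin.insertNth_self_removeNth (firstMaxIndex u) u,
            ← Fin.insertNth_self_removeNth (firstMaxIndex v) v]
          change ((firstMaxIndex u).insertNth (maxEntry u) (deleteFirstMax u) : Fin (k + 1) → ℤ) =
            ((firstMaxIndex v).insertNth (maxEntry v) (deleteFirstMax v) : Fin (k + 1) → ℤ)
          rw [hM, hi, hd]
        · exact Or.inr (Or.inr (Or.inr ⟨hM.symm, Or.inr ⟨hi, hd⟩⟩))
      · exact Or.inr (Or.inr (Or.inr ⟨hM.symm, Or.inl hi⟩))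
    · exact Or.inr (Or.inr (Or.inl h))

theorem vecPrec_iff {k : ℕ} {u v : Fin k → ℤ} :
    VecPrec k u v ↔ vecCode (fun i => intRank (u i)) < vecCode (fun i => intRank (v i)) := by
  refine ⟨vecCode_lt_of_vecPrec, fun h => ?_⟩
  rcases vecPrec_trichotomous u v with h' | rfl | h'
  · exact h'
  · exact absurd h (lt_irrefl _)
  · exact absurd h (vecCode_lt_of_vecPrec h').not_gt

/-- The relabelling of integer vectors by the positions of their entries. -/
noncomputable def rankEquiv (k : ℕ) : (Fin k → ℤ) ≃ (Fin k → ℕ) :=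
  Equiv.piCongrRight fun _ => Equiv.ofBijective intRank intRank_bijective

theorem rankEquiv_apply {k : ℕ} (u : Fin k → ℤ) : rankEquiv k u = fun i => intRank (u i) := rfl

theorem isInitialSegment_iff {k : ℕ} {S : Finset (Fin k → ℤ)} :
    IsInitialSegment S ↔ IsCodeInitial (S.map (rankEquiv k).toEmbedding) := by
  simp only [IsInitialSegment, IsCodeInitial, vecPrec_iff, ← rankEquiv_apply]
  constructor
  · intro h v hv u huv
    rw [Finset.mem_map_equiv] at hv ⊢
    exact h _ hv _ (by simpa using huv)
  · intro h v hv u huv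
    have := h _ (Finset.mem_map_of_mem _ hv) _ huv
    simpa using this

theorem card_deleteCoords {k : ℕ} (b : Fin k → Bool) (X : Finset (Fin k → ℤ)) :
    (deleteCoords {i | b i} X).card =
      (zeroCoords b (X.map (rankEquiv k).toEmbedding)).card := by
  -- Ranking the kept entries and padding the deleted ones with `0` is injective and carries the
  -- projection to the zeroed set.
  let ψ (y : ((({i | b i} : Finset (Fin k))ᶜ : Finset (Fin k)) → ℤ)) (i : Fin k) : ℕ :=
    if h : i ∈ ({i | b i} : Finset (Fin k))ᶜ then intRank (y ⟨i, h⟩) else 0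
  have hψ : Function.Injective ψ := by
    intro y z h
    funext ⟨i, hi⟩
    have := congrFun h i
    simp only [ψ, hi, dif_pos] at this
    exact intRank_bijective.1 this
  rw [← Finset.card_image_of_injective _ hψ, deleteCoords, zeroCoords, Finset.image_image,
    Finset.map_eq_image, Finset.image_image]
  congr 1
  refine Finset.image_congr fun x _ => funext fun i => ?_
  by_cases hb : b i <;> simp [ψ, hb, rankEquiv_apply]

theorem projectionSum_eq_natProjectionSum {k : ℕ} (X : Finset (Fin k → ℤ)) :
    projectionSum X = natProjectionSum (X.map (rankEquiv k).toEmbedding) := by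
  rw [projectionSum, natProjectionSum, Nat.cast_sum]
  symm
  refine Finset.sum_nbij' (fun b => ({i | b i} : Finset (Fin k))) (fun I i => decide (i ∈ I))
    (by simp) (by simp) (by simp) (by simp) fun b _ => ?_
  rw [← card_deleteCoords, Nat.cast_mul]
  congr 1
  simp [Finset.prod_ite]

theorem mainTheorem5 (k : ℕ) (hk : 1 ≤ k) (n : ℕ) :
    ∃ S : Finset (Fin k → ℤ),
      (IsInitialSegment S ∧ S.card = n) ∧
      (∀ T : Finset (Fin k → ℤ), IsInitialSegment T → T.card = n → T = S) ∧
      IsMinOn (fun X : Finset (Fin k → ℤ) => projectionSum X) {X | X.card = n} S := by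
  -- This makes `Fin k → ℕ` infinite, so sets of every size exist; it is where `k ≥ 1` is used.
  have : Nonempty (Fin k) := ⟨⟨0, hk⟩⟩
  obtain ⟨X₀, hX₀⟩ := Infinite.exists_subset_card_eq (Fin k → ℕ) n
  obtain ⟨S, hS⟩ : ∃ S : Finset (Fin k → ℤ), S.map (rankEquiv k).toEmbedding = codeSegment X₀ :=
    ⟨(codeSegment X₀).map (rankEquiv k).symm.toEmbedding, by simp [Finset.map_map]⟩
  have hinit : IsCodeInitial (S.map (rankEquiv k).toEmbedding) :=
    hS ▸ codeSegment_isCodeInitial X₀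
  have hcard : S.card = n := by
    rw [← Finset.card_map (rankEquiv k).toEmbedding, hS, card_codeSegment, hX₀]
  refine ⟨S, ⟨isInitialSegment_iff.2 hinit, hcard⟩, fun T hT hTn => ?_, fun X hX => ?_⟩
  · refine Finset.map_injective (rankEquiv k).toEmbedding
      ((isInitialSegment_iff.1 hT).eq_of_card_eq hinit ?_)
    rw [Finset.card_map, Finset.card_map, hTn, hcard]
  · have hXn : X.card = n := hX
    change projectionSum S ≤ projectionSum X
    rw [projectionSum_eq_natProjectionSum, projectionSum_eq_natProjectionSum,
      Nat.cast_le]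
    refine natProjectionSum_le_of_isCodeInitial hinit ?_
    rw [Finset.card_map, Finset.card_map, hXn, hcard]
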